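/- For real $p,r$ let $A_0(p,r)=1$ and $A_k(p,r)=\frac{r}{k!}\prod_{i=1}^{k-1}(kp+r-i)$ for $k\ge 1$ be the Fuss-Catalan (Raney) numbers. A measure $\nu$ on $\mathbb{R}$ is called unimodal if there are $a\in\mathbb{R}$, $c\ge 0$ and a function $f\ge 0$, non-decreasing on $(-\infty,a)$ and non-increasing on $(a,\infty)$, such that $\nu(\mathrm{d}x)=c\,\delta_a+f(x)\,\mathrm{d}x$. Let $r\ge 1$ be real. There is exactly one probability measure $\mu(2r,r)$ on $\mathbb{R}$ (the Fuss-Catalan distribution) that has finite moments of all orders with $\int_{\mathbb{R}} x^k\,\mu(2r,r)(\mathrm{d}x)=A_k(2r,r)$ for all $k\ge 0$, and $\mu(2r,r)$ is unimodal. Moreover, put $$\rho(\varphi)=\frac{\sin(2r\varphi)^{2r}}{\sin(\varphi)\,\sin((2r-1)\varphi)^{2r-1}},\qquad 0<\varphi<\frac{\pi}{2r}.$$ Then $\mu(2r,r)$ is absolutely continuous with respect to Lebesgue measure, with a Borel measurable density $W_{2r,r}\ge 0$ that vanishes outside $\rho\big((0,\pi/(2r))\big)$ and satisfies $$W_{2r,r}(\rho(\varphi))=\frac{\sin((2r-1)\varphi)^{r-1}\,\sin(\varphi)\,\sin(r\varphi)}{\pi\,\sin(2r\varphi)^{r}},\qquad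 0<\varphi<\frac{\pi}{2r},$$ and the function $\varphi\mapsto W_{2r,r}(\rho(\varphi))$ is non-decreasing on $(0,\pi/(2r))$. -/

import Mathlib

open MeasureTheory Set
open scoped NNReal ENNReal

noncomputable section

/-- The two-parameter Fuss-Catalan (Raney) numbers: `A₀(p, r) = 1` and
`A_k(p, r) = (r / k!) * ∏_{i=1}^{k-1} (k p + r - i)` for `k ≥ 1`. -/
def fussCatalanNumber (p r : ℝ) : ℕ → ℝ
  | 0 => 1
  | k + 1 =>
      r / ((k + 1).factorial : ℝ) * ∏ i ∈ Finset.Icc 1 k, (((k + 1 : ℕ) : ℝ) * p + r - (i : ℝ))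

/-- `μ` is a Fuss-Catalan distribution with parameters `p, r`: a probability measure on `ℝ` that
has moments of all orders, the `k`-th one being `A_k(p, r)`. -/
structure IsFussCatalanDistribution (p r : ℝ) (μ : Measure ℝ) : Prop where
  isProbabilityMeasure : IsProbabilityMeasure μ
  integrable_pow : ∀ k : ℕ, Integrable (fun x : ℝ => x ^ k) μ
  integral_pow : ∀ k : ℕ, ∫ x, x ^ k ∂μ = fussCatalanNumber p r k

/-- `ν` is unimodal with mode `a`: `ν(dx) = c δ_a + f(x) dx`, where `c ≥ 0` and `f ≥ 0` is
non-decreasing on `(-∞, a)` and non-increasing on `(a, ∞)`. -/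
def IsUnimodalWithMode (ν : Measure ℝ) (a : ℝ) : Prop :=
  ∃ (c : ℝ≥0) (f : ℝ → ℝ), (∀ x, 0 ≤ f x) ∧ MonotoneOn f (Iio a) ∧ AntitoneOn f (Ioi a) ∧
    ν = (c : ℝ≥0∞) • Measure.dirac a + volume.withDensity (fun x => ENNReal.ofReal (f x))

/-- `ν` is unimodal (with some mode). -/
def IsUnimodal (ν : Measure ℝ) : Prop :=
  ∃ a : ℝ, IsUnimodalWithMode ν a

/-- The parametrization `ρ(φ) = sin(pφ)^p / (sin φ * sin((p-1)φ)^(p-1))`, for `0 < φ < π / p`. -/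
def fussCatalanParam (p φ : ℝ) : ℝ :=
  Real.sin (p * φ) ^ p / (Real.sin φ * Real.sin ((p - 1) * φ) ^ (p - 1))

end

/-!
Along the arc in the upper half-plane on which `z ^ p / (z - 1)` is real, this quotient equals the
parameter `ρ` and decreases to `0`. The `k`-th moment of the candidate density is, after the
substitution `x = ρ(φ)`, the imaginary part of the integral along that arc of
`π⁻¹ * z ^ (p * k + r) / (z - 1) ^ k` against the logarithmic differential of `(z - 1) / z ^ p`.
The integrand is holomorphic, so the arc matters only through its end points, a real point
`x > 1` and the origin, and integration by parts gives binomial coefficients that add up to the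
Raney numbers. The bounded support makes the moment problem determinate.

The function `x * cot x` decreases on `(0, π)`, hence `ρ` is decreasing and
`sin (a * φ) / sin (b * φ)` is increasing for `a ≤ b`. The angular density is a product of
nonnegative increasing factors of this kind, so the density is nonincreasing on `(0, ∞)`.
-/

open Filter Topology

section Determinacy

open ProbabilityTheory

theorem hasSum_complexMGF {Ω : Type*} [MeasurableSpace Ω] {μ : Measure Ω} {X : Ω → ℝ} {z : ℂ}
    (hX : ∀ k : ℕ, Integrable (fun ω => X ω ^ k) μ)
    (hsum : Summable fun k : ℕ => ‖z‖ ^ k / k.factorial * ∫ ω, |X ω| ^ k ∂μ) :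
    HasSum (fun k : ℕ => z ^ k / k.factorial * ((∫ ω, X ω ^ k ∂μ : ℝ) : ℂ))
      (complexMGF X μ z) := by
  have hint (k : ℕ) : Integrable (fun ω => z ^ k / k.factorial * ((X ω ^ k : ℝ) : ℂ)) μ :=
    (hX k).ofReal.const_mul _
  have hexp (ω : Ω) : ∑' k : ℕ, z ^ k / k.factorial * ((X ω ^ k : ℝ) : ℂ) =
      Complex.exp (z * X ω) := by
    rw [Complex.exp_eq_exp_ℂ, NormedSpace.exp_eq_tsum_div]
    refine tsum_congr fun k => ?_
    rw [mul_pow, Complex.ofReal_pow, div_mul_eq_mul_div]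
  have h := hasSum_integral_of_summable_integral_norm hint <| by
    simpa [integral_const_mul, abs_pow] using hsum
  simpa only [hexp, integral_const_mul, integral_complex_ofReal, complexMGF] using h

theorem integral_abs_pow_le_of_integral_pow_two_mul_le {μ : Measure ℝ} [IsProbabilityMeasure μ]
    {k : ℕ} (hμ : Integrable (fun x : ℝ => x ^ (2 * k)) μ) {C : ℝ} (hC : 0 ≤ C)
    (h : ∫ x, x ^ (2 * k) ∂μ ≤ C ^ (2 * k)) : ∫ x, |x| ^ k ∂μ ≤ C ^ k := by
  have hsq (x : ℝ) : (|x| ^ k) ^ 2 = x ^ (2 * k) := by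
    rw [← pow_mul, mul_comm, pow_mul, sq_abs, pow_mul]
  have hL2 : MemLp (fun x : ℝ => |x| ^ k) 2 μ :=
    (memLp_two_iff_integrable_sq (by fun_prop)).2 (by simpa only [hsq] using hμ)
  have hvar := variance_nonneg (fun x : ℝ => |x| ^ k) μ
  simp only [variance_eq_sub hL2, Pi.pow_apply, hsq] at hvar
  refine le_of_sq_le_sq ?_ (by positivity)
  rw [← pow_mul, mul_comm]
  linarith

theorem measure_eq_of_integral_pow_eq {μ ν : Measure ℝ} [IsProbabilityMeasure μ]
    [IsProbabilityMeasure ν] (hμ : ∀ k : ℕ, Integrable (fun x : ℝ => x ^ k) μ)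
    (hν : ∀ k : ℕ, Integrable (fun x : ℝ => x ^ k) ν)
    (h : ∀ k : ℕ, ∫ x, x ^ k ∂μ = ∫ x, x ^ k ∂ν) {C : ℝ} (hC : 0 ≤ C)
    (hle : ∀ k : ℕ, ∫ x, x ^ (2 * k) ∂ν ≤ C ^ (2 * k)) : μ = ν := by
  have hasSum {κ : Measure ℝ} [IsProbabilityMeasure κ]
      (hκ : ∀ k : ℕ, Integrable (fun x : ℝ => x ^ k) κ)
      (hle : ∀ k : ℕ, ∫ x, x ^ (2 * k) ∂κ ≤ C ^ (2 * k)) (z : ℂ) :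
      HasSum (fun k : ℕ => z ^ k / k.factorial * ((∫ x, x ^ k ∂κ : ℝ) : ℂ))
        (complexMGF id κ z) := by
    refine hasSum_complexMGF hκ ?_
    refine .of_nonneg_of_le (fun k => by positivity) (fun k => ?_)
      (Real.summable_pow_div_factorial (‖z‖ * C))
    rw [mul_pow, mul_div_right_comm]
    gcongr
    exact integral_abs_pow_le_of_integral_pow_two_mul_le (hκ _) hC (hle k)
  refine Measure.ext_of_complexMGF_id_eq (funext fun z => ?_)
  have hsumμ := hasSum hμ (fun k => (h _).trans_le (hle k)) z
  simp only [h] at hsumμ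
  exact hsumμ.unique (hasSum hν hle z)

end Determinacy

section Binomial

theorem succ_mul_choose_succ {R : Type*} [CommRing R] [BinomialRing R] (a : R) (k : ℕ) :
    (k + 1) * Ring.choose a (k + 1) = a * Ring.choose (a - 1) k := by
  simpa [nsmul_eq_mul] using Ring.choose_smul_choose a (Nat.le_add_left 1 k)

theorem factorial_mul_choose {R : Type*} [CommRing R] [BinomialRing R] (a : R) (k : ℕ) :
    k.factorial * Ring.choose a k = ∏ i ∈ Finset.range k, (a - i) := by
  induction k generalizing a with
  | zero => simp
  | succ k ih =>
    rw [Nat.factorial_succ, Nat.cast_mul, mul_right_comm, Nat.cast_succ, succ_mul_choose_succ,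
      mul_assoc, mul_comm (Ring.choose _ _), ih, Finset.prod_range_succ', mul_comm]
    simp only [Nat.cast_add, Nat.cast_one, Nat.cast_zero, sub_zero, sub_sub, add_comm]

theorem fussCatalanNumber_succ_eq_choose_sub (p r : ℝ) (k : ℕ) :
    fussCatalanNumber p r (k + 1) =
      Ring.choose (p * (k + 1) + r) (k + 1) - p * Ring.choose (p * (k + 1) + r - 1) k := by
  have hk : (k : ℝ) + 1 ≠ 0 := by positivity
  have hprod : ∏ i ∈ Finset.Icc 1 k, (((k + 1 : ℕ) : ℝ) * p + r - i) =
      k.factorial * Ring.choose (p * (k + 1) + r - 1) k := by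
    rw [factorial_mul_choose, ← Finset.Ico_succ_right_eq_Icc, Finset.prod_Ico_eq_prod_range]
    refine Finset.prod_congr rfl fun i _ => ?_
    push_cast
    ring
  have hchoose := succ_mul_choose_succ (p * (k + 1) + r) k
  rw [fussCatalanNumber, hprod, ← mul_right_inj' hk, mul_sub, hchoose, Nat.factorial_succ]
  push_cast
  field_simp
  ring

end Binomial

section ArcIntegral

/-- The imaginary part of the integral of `f` along an arc in the upper half-plane, from a real
point `x > 1` to the origin, is `c`. The integral is encoded by a primitive of `f`, whose
imaginary part has the boundary values `0` on `(1, ∞)` and `c` at `0`. -/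
def HasImArcIntegral (f : ℂ → ℂ) (c : ℝ) : Prop :=
  ∃ F : ℂ → ℂ, (∀ z : ℂ, 0 < z.im → HasDerivAt F (f z) z) ∧
    (∀ x : ℝ, 1 < x → Tendsto (fun z => (F z).im) (𝓝[{z | 0 < z.im}] x) (𝓝 0)) ∧
    Tendsto (fun z => (F z).im) (𝓝[{z | 0 < z.im}] 0) (𝓝 c)

variable {f g : ℂ → ℂ} {a c d : ℝ} {k : ℕ} {z : ℂ}

namespace HasImArcIntegral

theorem congr (hf : HasImArcIntegral f c) (hfg : ∀ z : ℂ, 0 < z.im → f z = g z) :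
    HasImArcIntegral g c := by
  obtain ⟨F, hF, hFx, hF0⟩ := hf
  exact ⟨F, fun z hz => hfg z hz ▸ hF z hz, hFx, hF0⟩

theorem add (hf : HasImArcIntegral f c) (hg : HasImArcIntegral g d) :
    HasImArcIntegral (fun z => f z + g z) (c + d) := by
  obtain ⟨F, hF, hFx, hF0⟩ := hf
  obtain ⟨G, hG, hGx, hG0⟩ := hg
  exact ⟨fun z => F z + G z, fun z hz => (hF z hz).add (hG z hz),
    fun x hx => by simpa using (hFx x hx).add (hGx x hx), by simpa using hF0.add hG0⟩

theorem const_mul (a : ℝ) (hf : HasImArcIntegral f c) :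
    HasImArcIntegral (fun z => a * f z) (a * c) := by
  obtain ⟨F, hF, hFx, hF0⟩ := hf
  exact ⟨fun z => a * F z, fun z hz => (hF z hz).const_mul _,
    fun x hx => by simpa using (hFx x hx).const_mul a, by simpa using hF0.const_mul a⟩

end HasImArcIntegral

theorem sub_one_ne_zero_of_im_pos (hz : 0 < z.im) : z - 1 ≠ 0 := by
  rintro h
  simp [sub_eq_zero.1 h] at hz

theorem hasDerivAt_cpow_div_sub_one_pow (a : ℝ) (k : ℕ) (hz : 0 < z.im) :
    HasDerivAt (fun z : ℂ => z ^ (a : ℂ) / (z - 1) ^ k)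
      (a * (z ^ ((a - 1 : ℝ) : ℂ) / (z - 1) ^ k) +
        (-k : ℝ) * (z ^ (a : ℂ) / (z - 1) ^ (k + 1))) z := by
  have hz1 := sub_one_ne_zero_of_im_pos hz
  have hcpow := (hasDerivAt_id z).cpow_const (c := (a : ℂ)) (.inr hz.ne')
  have hpow := ((hasDerivAt_id z).sub_const 1).pow k
  refine (hcpow.div hpow (pow_ne_zero k hz1)).congr_deriv ?_
  simp only [id, Pi.pow_apply]
  cases k with
  | zero => simp
  | succ k =>
    push_cast
    field_simp
    ring

theorem tendsto_im_cpow_div_sub_one_pow (ha : 0 < a) (k : ℕ) {x : ℝ} (hx : 0 ≤ x) (hx1 : x ≠ 1) :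
    Tendsto (fun z : ℂ => (z ^ (a : ℂ) / (z - 1) ^ k).im) (𝓝 x) (𝓝 0) := by
  have hne : (x : ℂ) - 1 ≠ 0 := by exact_mod_cast sub_ne_zero.2 hx1
  have hreal : ((x : ℂ) ^ (a : ℂ) / (x - 1) ^ k).im = 0 := by
    rw [← Complex.ofReal_cpow hx]
    exact_mod_cast Complex.ofReal_im (x ^ a / (x - 1) ^ k)
  have hcont : ContinuousAt (fun z : ℂ => z ^ (a : ℂ) / (z - 1) ^ k) x :=
    (Complex.continuousAt_cpow_const_of_re_pos (.inl hx) ha).div (by fun_prop) (pow_ne_zero k hne)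
  simpa only [Function.comp_def, hreal] using
    (Complex.continuous_im.continuousAt.comp hcont).tendsto

theorem hasImArcIntegral_deriv_cpow_div (ha : 0 < a) (k : ℕ) :
    HasImArcIntegral (fun z => a * (z ^ ((a - 1 : ℝ) : ℂ) / (z - 1) ^ k) +
      (-k : ℝ) * (z ^ (a : ℂ) / (z - 1) ^ (k + 1))) 0 := by
  refine ⟨fun z => z ^ (a : ℂ) / (z - 1) ^ k,
    fun _ hz => hasDerivAt_cpow_div_sub_one_pow a k hz, fun x hx => ?_, ?_⟩
  · exact tendsto_nhdsWithin_of_tendsto_nhds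
      (tendsto_im_cpow_div_sub_one_pow ha k (by linarith) hx.ne')
  · apply tendsto_nhdsWithin_of_tendsto_nhds
    simpa using tendsto_im_cpow_div_sub_one_pow ha k le_rfl zero_ne_one

theorem hasImArcIntegral_inv_sub_one : HasImArcIntegral (fun z => (z - 1)⁻¹) Real.pi := by
  refine ⟨fun z => Complex.log (z - 1), fun z hz => ?_, fun x hx => ?_, ?_⟩
  · simpa using ((hasDerivAt_id z).sub_const 1).clog (.inr (by simpa using hz.ne'))
  · have hlog : ContinuousAt (fun z : ℂ => Complex.log (z - 1)) x :=
      ContinuousAt.clog (by fun_prop) (.inl (by simpa using hx))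
    have hreal : (Complex.log ((x : ℂ) - 1)).im = 0 := by
      rw [Complex.log_im, ← Complex.ofReal_one, ← Complex.ofReal_sub,
        Complex.arg_ofReal_of_nonneg (by linarith)]
    have h := (Complex.continuous_im.continuousAt.comp hlog).tendsto
    simp only [Function.comp_def, hreal] at h
    exact h.mono_left nhdsWithin_le_nhds
  · have harg := (Complex.continuousWithinAt_arg_of_re_neg_of_im_zero (z := -1)
      (by simp) (by simp)).tendsto
    have hsub : Tendsto (fun z : ℂ => z - 1) (𝓝[{z | 0 < z.im}] 0)
        (𝓝[{z : ℂ | 0 ≤ z.im}] (-1)) := by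
      refine tendsto_nhdsWithin_iff.2 ⟨tendsto_nhdsWithin_of_tendsto_nhds ?_, ?_⟩
      · simpa using (by fun_prop : Continuous fun z : ℂ => z - 1).tendsto 0
      · filter_upwards [self_mem_nhdsWithin] with z hz
        simpa using le_of_lt hz
    simpa [Function.comp_def, Complex.log_im] using harg.comp hsub

theorem convex_im_nonneg_inter_slitPlane :
    Convex ℝ ({z : ℂ | 0 ≤ z.im} ∩ Complex.slitPlane) := by
  rw [convex_iff_forall_pos]
  rintro z ⟨hz0, hz⟩ w ⟨hw0, hw⟩ s t hs ht -
  rw [mem_ofPred_eq] at hz0 hw0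
  rw [Complex.mem_slitPlane_iff] at hz hw
  simp only [mem_inter_iff, mem_ofPred_eq, Complex.mem_slitPlane_iff, Complex.add_im,
    Complex.add_re, Complex.real_smul, Complex.im_ofReal_mul, Complex.re_ofReal_mul]
  refine ⟨by positivity, ?_⟩
  by_cases h : z.im = 0 ∧ w.im = 0
  · left
    have := hz.resolve_right (not_not.2 h.1)
    have := hw.resolve_right (not_not.2 h.2)
    positivity
  · right
    rcases not_and_or.1 h with h | h
    · have := hz0.lt_of_ne' h
      positivity
    · have := hw0.lt_of_ne' h
      positivity

theorem exists_primitive_im_eq_zero (hf : DifferentiableOn ℂ f Complex.slitPlane)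
    (hreal : ∀ x : ℝ, 0 < x → (f x).im = 0) :
    ∃ F : ℂ → ℂ, (∀ z ∈ {z : ℂ | 0 ≤ z.im} ∩ Complex.slitPlane,
        HasDerivWithinAt F (f z) ({z : ℂ | 0 ≤ z.im} ∩ Complex.slitPlane) z) ∧
      ∀ x : ℝ, 0 < x → (F x).im = 0 := by
  obtain ⟨F, hF⟩ := convex_im_nonneg_inter_slitPlane.exists_forall_hasDerivWithinAt
    (hf.mono inter_subset_right)
  have hmaps : MapsTo ((↑) : ℝ → ℂ) (Ioi 0) ({z : ℂ | 0 ≤ z.im} ∩ Complex.slitPlane) :=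
    fun x hx => ⟨by simp, by simpa using hx⟩
  have hderiv (x : ℝ) (hx : x ∈ Ioi (0 : ℝ)) :
      HasDerivWithinAt (fun x : ℝ => (F x).im) 0 (Ioi 0) x := by
    have h := (hF x (hmaps hx)).scomp x Complex.ofRealCLM.hasDerivWithinAt hmaps
    refine (Complex.imCLM.hasFDerivAt.comp_hasDerivWithinAt x h).congr_deriv ?_
    simp [hreal x hx]
  refine ⟨fun z => F z - F 1, fun z hz => (hF z hz).sub_const _, fun x hx => ?_⟩
  have h := (convex_Ioi (0 : ℝ)).norm_image_sub_le_of_norm_hasDerivWithin_le hderiv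
    (fun _ _ => norm_zero.le) (mem_Ioi.2 one_pos) hx
  simpa using h

theorem hasImArcIntegral_zero_of_im_eq_zero (hf : DifferentiableOn ℂ f Complex.slitPlane)
    (hf0 : ContinuousAt f 0) (hreal : ∀ x : ℝ, 0 < x → (f x).im = 0) : HasImArcIntegral f 0 := by
  obtain ⟨F, hF, hFreal⟩ := exists_primitive_im_eq_zero hf hreal
  set S : Set ℂ := {z | 0 ≤ z.im} ∩ Complex.slitPlane
  have hsub : {z : ℂ | 0 < z.im} ⊆ S :=
    fun z (hz : 0 < z.im) => ⟨hz.le, .inr hz.ne'⟩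
  have hmem {x : ℝ} (hx : 0 < x) : (x : ℂ) ∈ S := ⟨by simp, by simpa using hx⟩
  refine ⟨F, fun z hz => (hF z (hsub hz)).hasDerivAt (mem_of_superset ?_ hsub), fun x hx => ?_, ?_⟩
  · exact (isOpen_lt continuous_const Complex.continuous_im).mem_nhds hz
  · have h := Complex.continuous_im.continuousAt.comp_continuousWithinAt
      (hF x (hmem (by linarith))).continuousWithinAt
    simpa [Function.comp_def, hFreal x (by linarith)] using
      h.tendsto.mono_left (nhdsWithin_mono _ hsub)
  · obtain ⟨ε, hε, hbdd⟩ := Metric.eventually_nhds_iff_ball.1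
      (hf0.norm.eventually_lt_const (lt_add_one ‖f 0‖))
    have hlip : ∀ᶠ z : ℂ in 𝓝[{z | 0 < z.im}] 0,
        ‖(F z).im‖ ≤ (‖f 0‖ + 1) * ‖z - (‖z‖ : ℂ)‖ := by
      filter_upwards [nhdsWithin_le_nhds (Metric.ball_mem_nhds 0 hε), self_mem_nhdsWithin]
        with z hzε hz
      have hz0 : 0 < ‖z‖ := norm_pos_iff.2 fun h => by simp [h] at hz
      have h := (convex_im_nonneg_inter_slitPlane.inter (convex_ball (0 : ℂ) ε)
        ).norm_image_sub_le_of_norm_hasDerivWithin_le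
        (fun w hw => (hF w hw.1).mono inter_subset_left) (fun w hw => (hbdd w hw.2).le)
        ⟨hmem hz0, by simpa using hzε⟩ ⟨hsub hz, hzε⟩
      simpa [hFreal _ hz0] using (Complex.abs_im_le_norm _).trans h
    refine squeeze_zero_norm' hlip (tendsto_nhdsWithin_of_tendsto_nhds ?_)
    simpa using (by fun_prop :
      Continuous fun z : ℂ => (‖f 0‖ + 1) * ‖z - (‖z‖ : ℂ)‖).tendsto 0

theorem hasImArcIntegral_dslope_cpow (ha : 0 < a) :
    HasImArcIntegral (dslope (fun z : ℂ => z ^ (a : ℂ)) 1) 0 := by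
  have hcpow : DifferentiableOn ℂ (fun z : ℂ => z ^ (a : ℂ)) Complex.slitPlane :=
    fun z hz => (differentiableAt_id.cpow_const hz).differentiableWithinAt
  refine hasImArcIntegral_zero_of_im_eq_zero ?_ ?_ fun x hx => ?_
  · exact (Complex.differentiableOn_dslope
      (Complex.isOpen_slitPlane.mem_nhds Complex.one_mem_slitPlane)).2 hcpow
  · exact (continuousAt_dslope_of_ne zero_ne_one).2
      (Complex.continuousAt_cpow_const_of_re_pos (.inl le_rfl) ha)
  · by_cases h : x = 1
    · have hderiv := (hasDerivAt_id (1 : ℂ)).cpow_const (c := (a : ℂ)) (.inl (by simp))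
      simpa [h] using congrArg Complex.im hderiv.deriv
    · rw [dslope_of_ne _ (by exact_mod_cast h), slope_def_field, ← Complex.ofReal_cpow hx.le,
        Complex.one_cpow]
      exact_mod_cast Complex.ofReal_im ((x ^ a - 1) / (x - 1))

/-- Integration by parts lowers `k` and `a` by one. -/
theorem hasImArcIntegral_cpow_div (ha : k < a) :
    HasImArcIntegral (fun z => z ^ (a : ℂ) / (z - 1) ^ (k + 1)) (Real.pi * Ring.choose a k) := by
  induction k generalizing a with
  | zero =>
    have h := hasImArcIntegral_inv_sub_one.add
      (hasImArcIntegral_dslope_cpow (by simpa using ha : 0 < a))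
    simp only [Ring.choose_zero_right, mul_one]
    refine (add_zero Real.pi ▸ h).congr fun z hz => ?_
    have hz1 := sub_one_ne_zero_of_im_pos hz
    rw [dslope_of_ne _ (sub_ne_zero.1 hz1), slope_def_field, Complex.one_cpow]
    field_simp
    ring
  | succ k ih =>
    push_cast at ha
    have ha0 : 0 < a := k.cast_nonneg.trans_lt (by linarith)
    have hk : (k : ℝ) + 1 ≠ 0 := by positivity
    have hval : a / (k + 1) * (Real.pi * Ring.choose (a - 1) k) + -1 / (k + 1) * 0 =
        Real.pi * Ring.choose a (k + 1) := by
      field_simp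
      linear_combination -Real.pi * succ_mul_choose_succ a k
    refine hval ▸ (((ih (a := a - 1) (by linarith)).const_mul (a / (k + 1))).add
      ((hasImArcIntegral_deriv_cpow_div ha0 (k + 1)).const_mul (-1 / (k + 1)))).congr
      fun z _ => ?_
    have hk' : (k : ℂ) + 1 ≠ 0 := by exact_mod_cast hk
    push_cast
    field_simp
    ring

theorem hasImArcIntegral_cpow_sub_one_div {p r : ℝ} (hp : 1 ≤ p) (hr : 0 < r) (k : ℕ) :
    HasImArcIntegral (fun z => z ^ ((p * k + r - 1 : ℝ) : ℂ) / (z - 1) ^ k)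
      (Real.pi * (Ring.choose (p * k + r) k - fussCatalanNumber p r k) / p) := by
  have hp0 : p ≠ 0 := by positivity
  cases k with
  | zero =>
    have h := (hasImArcIntegral_deriv_cpow_div hr 0).const_mul r⁻¹
    simp only [mul_zero] at h
    simpa [fussCatalanNumber, hr.ne'] using h
  | succ k =>
    have hpk : ((k + 1 : ℕ) : ℝ) ≤ p * (k + 1 : ℕ) := le_mul_of_one_le_left (Nat.cast_nonneg _) hp
    rw [Nat.cast_succ] at hpk ⊢
    have hval : Real.pi * (Ring.choose (p * (k + 1) + r) (k + 1) -
        fussCatalanNumber p r (k + 1)) / p =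
          Real.pi * Ring.choose (p * (k + 1) + r - 1) k := by
      rw [fussCatalanNumber_succ_eq_choose_sub]
      field_simp
      ring
    exact hval ▸ hasImArcIntegral_cpow_div (by linarith)

theorem hasImArcIntegral_fussCatalanNumber {p r : ℝ} (hp : 1 ≤ p) (hr : 0 < r) (k : ℕ) :
    HasImArcIntegral
      (fun z => z ^ ((p * k + r : ℝ) : ℂ) / (z - 1) ^ k * ((z - 1)⁻¹ - p / z))
      (Real.pi * fussCatalanNumber p r k) := by
  have hpk : (k : ℝ) ≤ p * k := le_mul_of_one_le_left k.cast_nonneg hp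
  have h := (hasImArcIntegral_cpow_div (k := k) (a := p * k + r) (by linarith)).add
    ((hasImArcIntegral_cpow_sub_one_div hp hr k).const_mul (-p))
  have hval : Real.pi * Ring.choose (p * k + r) k +
      -p * (Real.pi * (Ring.choose (p * k + r) k - fussCatalanNumber p r k) / p) =
        Real.pi * fussCatalanNumber p r k := by
    field_simp
    ring
  refine (hval ▸ h).congr fun z hz => ?_
  have hz1 := sub_one_ne_zero_of_im_pos hz
  have hz0 : z ≠ 0 := by
    rintro rfl
    simp at hz
  rw [Complex.ofReal_sub, Complex.cpow_sub _ _ hz0, Complex.ofReal_one, Complex.cpow_one]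
  push_cast
  field_simp
  ring

end ArcIntegral

section PathIntegral

theorem integral_Ioo_of_hasDerivAt_of_nonneg {f f' : ℝ → ℝ} {a b fa fb : ℝ} (hab : a < b)
    (hderiv : ∀ x ∈ Ioo a b, HasDerivAt f (f' x) x) (hpos : ∀ x ∈ Ioo a b, 0 ≤ f' x)
    (ha : Tendsto f (𝓝[>] a) (𝓝 fa)) (hb : Tendsto f (𝓝[<] b) (𝓝 fb)) :
    IntegrableOn f' (Ioo a b) ∧ ∫ x in Ioo a b, f' x = fb - fa := by
  have hcont : ContinuousOn f (Ioo a b) := fun x hx => (hderiv x hx).continuousAt.continuousWithinAt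
  have hderiv' : ∀ x ∈ Ioo a b, HasDerivAt (extendFrom (Ioo a b) f) (f' x) x := fun x hx =>
    (hderiv x hx).congr_of_eventuallyEq <| by
      filter_upwards [isOpen_Ioo.mem_nhds hx] with y hy using extendFrom_extends hcont y hy
  have hint : IntegrableOn f' (Ioc a b) := intervalIntegral.integrableOn_deriv_of_nonneg
    (continuousOn_Icc_extendFrom_Ioo hcont ha hb) hderiv' hpos
  refine ⟨hint.mono_set Ioo_subset_Ioc_self, ?_⟩
  rw [← integral_Ioc_eq_integral_Ioo, ← intervalIntegral.integral_of_le hab.le]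
  exact intervalIntegral.integral_eq_sub_of_hasDerivAt_of_tendsto hab hderiv
    ((intervalIntegrable_iff_integrableOn_Ioc_of_le hab.le).2 hint) ha hb

theorem HasImArcIntegral.integral_Ioo {f : ℂ → ℂ} {γ γ' : ℝ → ℂ} {a b c x : ℝ}
    (hf : HasImArcIntegral f c) (hab : a < b) (hγ : ∀ t ∈ Ioo a b, HasDerivAt γ (γ' t) t)
    (hγim : ∀ t ∈ Ioo a b, 0 < (γ t).im) (hpos : ∀ t ∈ Ioo a b, 0 ≤ (f (γ t) * γ' t).im)
    (hx : 1 < x) (ha : Tendsto γ (𝓝[>] a) (𝓝 x)) (hb : Tendsto γ (𝓝[<] b) (𝓝 0)) :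
    IntegrableOn (fun t => (f (γ t) * γ' t).im) (Ioo a b) ∧
      ∫ t in Ioo a b, (f (γ t) * γ' t).im = c := by
  obtain ⟨F, hF, hFx, hF0⟩ := hf
  have hderiv (t : ℝ) (ht : t ∈ Ioo a b) :
      HasDerivAt (fun t => (F (γ t)).im) (f (γ t) * γ' t).im t :=
    Complex.imCLM.hasFDerivAt.comp_hasDerivAt t ((hF _ (hγim t ht)).comp t (hγ t ht))
  have h := integral_Ioo_of_hasDerivAt_of_nonneg hab hderiv hpos
    ((hFx x hx).comp <| tendsto_nhdsWithin_iff.2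
      ⟨ha, mem_of_superset (Ioo_mem_nhdsGT hab) hγim⟩)
    (hF0.comp <| tendsto_nhdsWithin_iff.2 ⟨hb, mem_of_superset (Ioo_mem_nhdsLT hab) hγim⟩)
  simpa using h

end PathIntegral

section Trigonometry

theorem strictAntiOn_mul_cot : StrictAntiOn (fun x : ℝ => x * Real.cot x) (Ioo 0 Real.pi) := by
  have hderiv (x : ℝ) (hx : x ∈ Ioo 0 Real.pi) : HasDerivAt (fun x : ℝ => x * Real.cot x)
      ((Real.sin x * Real.cos x - x) / Real.sin x ^ 2) x := by
    have hsin : Real.sin x ≠ 0 := (Real.sin_pos_of_mem_Ioo hx).ne'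
    simp only [Real.cot_eq_cos_div_sin]
    refine ((hasDerivAt_id x).mul
      ((Real.hasDerivAt_cos x).div (Real.hasDerivAt_sin x) hsin)).congr_deriv ?_
    simp only [id, Pi.div_apply]
    field_simp
    linear_combination -x * Real.sin_sq_add_cos_sq x
  refine strictAntiOn_of_deriv_neg (convex_Ioo 0 Real.pi)
    (fun x hx => (hderiv x hx).continuousAt.continuousWithinAt) fun x hx => ?_
  rw [interior_Ioo] at hx
  rw [(hderiv x hx).deriv]
  have hsin := Real.sin_pos_of_mem_Ioo hx
  refine div_neg_of_neg_of_pos ?_ (by positivity)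
  nlinarith [Real.sin_lt hx.1, Real.cos_le_one x]

variable {a b c φ : ℝ}

theorem mul_mem_Ioo_zero_pi (ha : 0 < a) (hab : a ≤ b) (hφ : φ ∈ Ioo 0 (Real.pi / b)) :
    a * φ ∈ Ioo 0 Real.pi := by
  have hb : φ * b < Real.pi := (lt_div_iff₀ (ha.trans_le hab)).1 hφ.2
  exact ⟨mul_pos ha hφ.1, by nlinarith [hφ.1]⟩

theorem sin_mul_pos (ha : 0 < a) (hab : a ≤ b) (hφ : φ ∈ Ioo 0 (Real.pi / b)) :
    0 < Real.sin (a * φ) :=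
  Real.sin_pos_of_mem_Ioo (mul_mem_Ioo_zero_pi ha hab hφ)

theorem mul_cot_mul_lt_mul_cot_mul (ha : 0 < a) (hab : a < b) (hφ : φ ∈ Ioo 0 (Real.pi / b)) :
    b * Real.cot (b * φ) < a * Real.cot (a * φ) := by
  have h := strictAntiOn_mul_cot (mul_mem_Ioo_zero_pi ha hab.le hφ)
    (mul_mem_Ioo_zero_pi (ha.trans hab) le_rfl hφ) (mul_lt_mul_of_pos_right hab hφ.1)
  have hφ0 := hφ.1
  refine lt_of_mul_lt_mul_left ?_ hφ0.le
  calc φ * (b * Real.cot (b * φ)) = b * φ * Real.cot (b * φ) := by ring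
    _ < a * φ * Real.cot (a * φ) := h
    _ = φ * (a * Real.cot (a * φ)) := by ring

theorem hasDerivAt_sin_mul (a φ : ℝ) :
    HasDerivAt (fun φ => Real.sin (a * φ)) (a * Real.cos (a * φ)) φ := by
  simpa [mul_comm] using ((hasDerivAt_id φ).const_mul a).sin

theorem hasDerivAt_sin_mul_div_sin_mul (ha : Real.sin (a * φ) ≠ 0) (hb : Real.sin (b * φ) ≠ 0) :
    HasDerivAt (fun φ => Real.sin (a * φ) / Real.sin (b * φ))
      (Real.sin (a * φ) / Real.sin (b * φ) * (a * Real.cot (a * φ) - b * Real.cot (b * φ))) φ := by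
  refine ((hasDerivAt_sin_mul a φ).div (hasDerivAt_sin_mul b φ) hb).congr_deriv ?_
  simp only [Real.cot_eq_cos_div_sin]
  generalize Real.sin (a * φ) = sa, Real.sin (b * φ) = sb at ha hb ⊢
  field_simp

theorem monotoneOn_sin_mul_div_sin_mul (ha : 0 < a) (hab : a ≤ b) :
    MonotoneOn (fun φ => Real.sin (a * φ) / Real.sin (b * φ)) (Ioo 0 (Real.pi / b)) := by
  rcases hab.eq_or_lt with rfl | hab
  · exact monotoneOn_const.congr fun φ hφ => (div_self (sin_mul_pos ha le_rfl hφ).ne').symm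
  have hderiv {φ : ℝ} (hφ : φ ∈ Ioo 0 (Real.pi / b)) :=
    hasDerivAt_sin_mul_div_sin_mul (sin_mul_pos ha hab.le hφ).ne'
      (sin_mul_pos (ha.trans hab) le_rfl hφ).ne'
  refine monotoneOn_of_deriv_nonneg (convex_Ioo 0 _)
    (fun φ hφ => (hderiv hφ).continuousAt.continuousWithinAt)
    (fun φ hφ => (hderiv (interior_subset hφ)).differentiableAt.differentiableWithinAt)
    fun φ hφ => ?_
  rw [interior_Ioo] at hφ
  rw [(hderiv hφ).deriv]
  have hsina := sin_mul_pos ha hab.le hφ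
  have hsinb := sin_mul_pos (ha.trans hab) le_rfl hφ
  have hcot := sub_pos.2 (mul_cot_mul_lt_mul_cot_mul ha hab hφ)
  positivity

theorem tendsto_sin_mul_div_sin_mul (a : ℝ) (hb : b ≠ 0) :
    Tendsto (fun φ => Real.sin (a * φ) / Real.sin (b * φ)) (𝓝[≠] 0) (𝓝 (a / b)) := by
  have hslope (c : ℝ) : Tendsto (fun φ => Real.sin (c * φ) / φ) (𝓝[≠] 0) (𝓝 c) := by
    simpa [div_eq_inv_mul] using (hasDerivAt_sin_mul c 0).tendsto_slope_zero
  refine ((hslope a).div (hslope b) hb).congr' ?_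
  filter_upwards [self_mem_nhdsWithin] with φ hφ
  exact div_div_div_cancel_right₀ hφ _ _

theorem hasDerivAt_sin_mul_div_sin_mul_mul_exp (c : ℝ) (ha : Real.sin (a * φ) ≠ 0)
    (hb : Real.sin (b * φ) ≠ 0) :
    HasDerivAt
      (fun φ : ℝ => ((Real.sin (a * φ) / Real.sin (b * φ) : ℝ) : ℂ) *
        Complex.exp ((c * φ : ℝ) * Complex.I))
      (((Real.sin (a * φ) / Real.sin (b * φ) : ℝ) : ℂ) * Complex.exp ((c * φ : ℝ) * Complex.I) *
        ((a * Real.cot (a * φ) - b * Real.cot (b * φ) : ℝ) + c * Complex.I)) φ := by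
  have hexp := ((((hasDerivAt_id φ).const_mul c).ofReal_comp).mul_const Complex.I).cexp
  refine ((hasDerivAt_sin_mul_div_sin_mul ha hb).ofReal_comp.mul hexp).congr_deriv ?_
  simp only [id]
  push_cast
  ring

theorem ofReal_mul_exp_mul_I_cpow (hc : 0 < c) (hφ : φ ∈ Ioc (-Real.pi) Real.pi) (a : ℝ) :
    ((c : ℂ) * Complex.exp (φ * Complex.I)) ^ (a : ℂ) =
      ((c ^ a : ℝ) : ℂ) * Complex.exp ((a * φ : ℝ) * Complex.I) := by
  have hlog : Complex.log (Complex.exp (φ * Complex.I)) = φ * Complex.I :=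
    Complex.log_exp (by simpa using hφ.1) (by simpa using hφ.2)
  rw [Complex.cpow_def_of_ne_zero (by simpa using hc.ne'),
    Complex.log_ofReal_mul hc (Complex.exp_ne_zero _), hlog, Real.rpow_def_of_pos hc,
    Complex.ofReal_exp, ← Complex.exp_add]
  push_cast
  ring_nf

end Trigonometry

section Curve

variable {p r φ : ℝ}

theorem sin_pos_of_mem_Ioo_pi_div (hp : 1 ≤ p) (hφ : φ ∈ Ioo 0 (Real.pi / p)) :
    0 < Real.sin φ := by
  simpa using sin_mul_pos one_pos hp hφ

theorem fussCatalanParam_pos (hp : 1 < p) (hφ : φ ∈ Ioo 0 (Real.pi / p)) :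
    0 < fussCatalanParam p φ := by
  have hx := sin_pos_of_mem_Ioo_pi_div hp.le hφ
  have hy := sin_mul_pos (sub_pos.2 hp) (sub_le_self p zero_le_one) hφ
  have hz := sin_mul_pos (zero_lt_one.trans hp) le_rfl hφ
  unfold fussCatalanParam
  positivity

theorem fussCatalanParam_eq_rpow_div (hp : 1 < p) (hφ : φ ∈ Ioo 0 (Real.pi / p)) :
    fussCatalanParam p φ = (Real.sin (p * φ) / Real.sin ((p - 1) * φ)) ^ p /
      (Real.sin φ / Real.sin ((p - 1) * φ)) := by
  have hy := sin_mul_pos (sub_pos.2 hp) (sub_le_self p zero_le_one) hφ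
  have hz := sin_mul_pos (zero_lt_one.trans hp) le_rfl hφ
  rw [fussCatalanParam, Real.div_rpow hz.le hy.le, Real.rpow_sub_one hy.ne']
  generalize Real.sin ((p - 1) * φ) = y at hy ⊢
  field_simp

/-- The derivative of `-log ρ`, where `ρ = fussCatalanParam p`. -/
noncomputable def fussCatalanLogDeriv (p φ : ℝ) : ℝ :=
  Real.cot φ + (p - 1) ^ 2 * Real.cot ((p - 1) * φ) - p ^ 2 * Real.cot (p * φ)

theorem fussCatalanLogDeriv_pos (hp : 1 < p) (hφ : φ ∈ Ioo 0 (Real.pi / p)) :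
    0 < fussCatalanLogDeriv p φ := by
  have hcot : p * Real.cot (p * φ) < Real.cot φ := by
    simpa using mul_cot_mul_lt_mul_cot_mul one_pos hp hφ
  have hcot' := mul_cot_mul_lt_mul_cot_mul (sub_pos.2 hp) (sub_one_lt p) hφ
  calc 0 < (p - 1) * ((p - 1) * Real.cot ((p - 1) * φ) - p * Real.cot (p * φ)) +
        (Real.cot φ - p * Real.cot (p * φ)) :=
        add_pos (mul_pos (sub_pos.2 hp) (sub_pos.2 hcot')) (sub_pos.2 hcot)
    _ = fussCatalanLogDeriv p φ := by
        unfold fussCatalanLogDeriv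
        ring

theorem hasDerivAt_fussCatalanParam (hp : 1 < p) (hφ : φ ∈ Ioo 0 (Real.pi / p)) :
    HasDerivAt (fussCatalanParam p) (-(fussCatalanParam p φ * fussCatalanLogDeriv p φ)) φ := by
  have hx := sin_pos_of_mem_Ioo_pi_div hp.le hφ
  have hy := sin_mul_pos (sub_pos.2 hp) (sub_le_self p zero_le_one) hφ
  have hz := sin_mul_pos (zero_lt_one.trans hp) le_rfl hφ
  have hnum := (hasDerivAt_sin_mul p φ).rpow_const (p := p) (Or.inl hz.ne')
  have hden := (Real.hasDerivAt_sin φ).mul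
    ((hasDerivAt_sin_mul (p - 1) φ).rpow_const (p := p - 1) (Or.inl hy.ne'))
  have hyp := Real.rpow_pos_of_pos hy (p - 1)
  refine (hnum.div hden (mul_pos hx hyp).ne').congr_deriv ?_
  simp only [Pi.mul_apply, fussCatalanParam, fussCatalanLogDeriv, Real.cot_eq_cos_div_sin]
  rw [Real.rpow_sub_one hz.ne' p, Real.rpow_sub_one hy.ne' (p - 1)]
  generalize Real.sin ((p - 1) * φ) ^ (p - 1) = yp at hyp ⊢
  generalize Real.sin (p * φ) ^ p = zp
  generalize Real.sin ((p - 1) * φ) = y at hy ⊢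
  generalize Real.cos ((p - 1) * φ) = cy
  field_simp
  ring

theorem strictAntiOn_fussCatalanParam (hp : 1 < p) :
    StrictAntiOn (fussCatalanParam p) (Ioo 0 (Real.pi / p)) := by
  refine strictAntiOn_of_deriv_neg (convex_Ioo _ _)
    (fun φ hφ => (hasDerivAt_fussCatalanParam hp hφ).continuousAt.continuousWithinAt)
    fun φ hφ => ?_
  rw [interior_Ioo] at hφ
  rw [(hasDerivAt_fussCatalanParam hp hφ).deriv, neg_lt_zero]
  exact mul_pos (fussCatalanParam_pos hp hφ) (fussCatalanLogDeriv_pos hp hφ)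

theorem tendsto_fussCatalanParam_zero (hp : 1 < p) :
    Tendsto (fussCatalanParam p) (𝓝[>] 0) (𝓝 (p ^ p / (p - 1) ^ (p - 1))) := by
  have hp1 : 0 < p - 1 := sub_pos.2 hp
  have hp0 : 0 < p := zero_lt_one.trans hp
  have hnum := (tendsto_sin_mul_div_sin_mul p hp1.ne').rpow_const (p := p) (Or.inr hp0.le)
  have hden := tendsto_sin_mul_div_sin_mul 1 hp1.ne'
  have hlim : (p / (p - 1)) ^ p / (1 / (p - 1)) = p ^ p / (p - 1) ^ (p - 1) := by
    rw [Real.div_rpow hp0.le hp1.le, Real.rpow_sub_one hp1.ne']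
    field_simp
  rw [← hlim]
  refine ((hnum.div hden (by positivity)).mono_left
    (nhdsWithin_mono 0 fun φ (hφ : 0 < φ) => hφ.ne')).congr' ?_
  filter_upwards [Ioo_mem_nhdsGT (div_pos Real.pi_pos hp0)] with φ hφ
  simp only [fussCatalanParam_eq_rpow_div hp hφ, Pi.div_apply, one_mul]

theorem fussCatalanParam_le (hp : 1 < p) (hφ : φ ∈ Ioo 0 (Real.pi / p)) :
    fussCatalanParam p φ ≤ p ^ p / (p - 1) ^ (p - 1) := by
  refine ge_of_tendsto (tendsto_fussCatalanParam_zero hp) ?_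
  filter_upwards [Ioo_mem_nhdsGT hφ.1] with ψ hψ
  exact ((strictAntiOn_fussCatalanParam hp) ⟨hψ.1, hψ.2.trans hφ.2⟩ hφ hψ.2).le

theorem sin_sub_one_mul_pi_div_pos (hp : 1 < p) : 0 < Real.sin ((p - 1) * (Real.pi / p)) := by
  have hp0 : 0 < p := zero_lt_one.trans hp
  refine Real.sin_pos_of_pos_of_lt_pi
    (mul_pos (sub_pos.2 hp) (div_pos Real.pi_pos hp0)) ?_
  rw [mul_div_assoc', div_lt_iff₀ hp0]
  nlinarith [Real.pi_pos]

theorem tendsto_fussCatalanParam_pi_div (hp : 1 < p) :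
    Tendsto (fussCatalanParam p) (𝓝[<] (Real.pi / p)) (𝓝 0) := by
  have hp0 : 0 < p := zero_lt_one.trans hp
  have hx : 0 < Real.sin (Real.pi / p) :=
    Real.sin_pos_of_pos_of_lt_pi (div_pos Real.pi_pos hp0) (div_lt_self Real.pi_pos hp)
  have hy := sin_sub_one_mul_pi_div_pos hp
  have hcont : ContinuousAt (fussCatalanParam p) (Real.pi / p) :=
    ((hasDerivAt_sin_mul p _).continuousAt.rpow_const (Or.inr hp0.le)).div
      (Real.continuous_sin.continuousAt.mul
        ((hasDerivAt_sin_mul (p - 1) _).continuousAt.rpow_const (Or.inl hy.ne')))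
      (mul_pos hx (Real.rpow_pos_of_pos hy _)).ne'
  have hzero : fussCatalanParam p (Real.pi / p) = 0 := by
    rw [fussCatalanParam, mul_div_cancel₀ _ hp0.ne', Real.sin_pi, Real.zero_rpow hp0.ne', zero_div]
  exact hzero ▸ hcont.tendsto.mono_left nhdsWithin_le_nhds

/-- The arc in the upper half-plane along which `z ^ p / (z - 1)` is real, parametrized by the
argument `φ ∈ (0, π / p)`; there `z ^ p / (z - 1) = fussCatalanParam p φ`. -/
noncomputable def fussCatalanCurve (p φ : ℝ) : ℂ :=
  ((Real.sin (p * φ) / Real.sin ((p - 1) * φ) : ℝ) : ℂ) * Complex.exp (φ * Complex.I)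

theorem fussCatalanCurve_sub_one (hy : Real.sin ((p - 1) * φ) ≠ 0) :
    fussCatalanCurve p φ - 1 = ((Real.sin φ / Real.sin ((p - 1) * φ) : ℝ) : ℂ) *
      Complex.exp ((p * φ : ℝ) * Complex.I) := by
  have hsin : Real.sin ((p - 1) * φ) =
      Real.sin (p * φ) * Real.cos φ - Real.cos (p * φ) * Real.sin φ := by
    rw [← Real.sin_sub, sub_one_mul]
  unfold fussCatalanCurve
  apply Complex.ext
  · rw [Complex.sub_re, Complex.re_ofReal_mul, Complex.re_ofReal_mul, Complex.exp_ofReal_mul_I_re,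
      Complex.exp_ofReal_mul_I_re, Complex.one_re, div_mul_eq_mul_div, div_mul_eq_mul_div,
      div_sub_one hy, hsin]
    ring
  · rw [Complex.sub_im, Complex.im_ofReal_mul, Complex.im_ofReal_mul, Complex.exp_ofReal_mul_I_im,
      Complex.exp_ofReal_mul_I_im, Complex.one_im]
    ring

theorem fussCatalanCurve_im_pos (hp : 1 < p) (hφ : φ ∈ Ioo 0 (Real.pi / p)) :
    0 < (fussCatalanCurve p φ).im := by
  have hx := sin_pos_of_mem_Ioo_pi_div hp.le hφ
  have hy := sin_mul_pos (sub_pos.2 hp) (sub_le_self p zero_le_one) hφ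
  have hz := sin_mul_pos (zero_lt_one.trans hp) le_rfl hφ
  rw [fussCatalanCurve, Complex.im_ofReal_mul, Complex.exp_ofReal_mul_I_im]
  positivity

theorem fussCatalanCurve_cpow (hp : 1 < p) (hφ : φ ∈ Ioo 0 (Real.pi / p)) (a : ℝ) :
    fussCatalanCurve p φ ^ (a : ℂ) =
      (((Real.sin (p * φ) / Real.sin ((p - 1) * φ)) ^ a : ℝ) : ℂ) *
        Complex.exp ((a * φ : ℝ) * Complex.I) := by
  have hy := sin_mul_pos (sub_pos.2 hp) (sub_le_self p zero_le_one) hφ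
  have hz := sin_mul_pos (zero_lt_one.trans hp) le_rfl hφ
  have hφπ : φ < Real.pi := hφ.2.trans (div_lt_self Real.pi_pos hp)
  exact ofReal_mul_exp_mul_I_cpow (div_pos hz hy) ⟨by linarith [hφ.1, Real.pi_pos], hφπ.le⟩ a

theorem fussCatalanCurve_cpow_self (hp : 1 < p) (hφ : φ ∈ Ioo 0 (Real.pi / p)) :
    fussCatalanCurve p φ ^ (p : ℂ) = fussCatalanParam p φ * (fussCatalanCurve p φ - 1) := by
  have hx := sin_pos_of_mem_Ioo_pi_div hp.le hφ
  have hy := sin_mul_pos (sub_pos.2 hp) (sub_le_self p zero_le_one) hφ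
  rw [fussCatalanCurve_sub_one hy.ne', fussCatalanCurve_cpow hp hφ, ← mul_assoc,
    ← Complex.ofReal_mul, fussCatalanParam_eq_rpow_div hp hφ,
    div_mul_cancel₀ _ (div_pos hx hy).ne']

theorem im_fussCatalanCurve_cpow_div (hp : 1 < p) (hφ : φ ∈ Ioo 0 (Real.pi / p)) (r : ℝ) (k : ℕ) :
    (fussCatalanCurve p φ ^ ((p * k + r : ℝ) : ℂ) / (fussCatalanCurve p φ - 1) ^ k).im =
      fussCatalanParam p φ ^ k *
        ((Real.sin (p * φ) / Real.sin ((p - 1) * φ)) ^ r * Real.sin (r * φ)) := by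
  have him := fussCatalanCurve_im_pos hp hφ
  have hne : fussCatalanCurve p φ ≠ 0 := fun h => by simp [h] at him
  have hexp : ((p * k + r : ℝ) : ℂ) = (p : ℂ) * (k : ℂ) + (r : ℂ) := by push_cast; rfl
  rw [hexp, Complex.cpow_add _ _ hne, Complex.cpow_mul_nat, fussCatalanCurve_cpow_self hp hφ,
    mul_pow, mul_assoc, mul_div_assoc,
    mul_div_cancel_left₀ _ (pow_ne_zero _ (sub_one_ne_zero_of_im_pos him)), ← Complex.ofReal_pow,
    Complex.im_ofReal_mul, fussCatalanCurve_cpow hp hφ, Complex.im_ofReal_mul,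
    Complex.exp_ofReal_mul_I_im]

theorem hasDerivAt_fussCatalanCurve (hp : 1 < p) (hφ : φ ∈ Ioo 0 (Real.pi / p)) :
    HasDerivAt (fussCatalanCurve p) (fussCatalanCurve p φ *
      ((p * Real.cot (p * φ) - (p - 1) * Real.cot ((p - 1) * φ) : ℝ) + Complex.I)) φ := by
  have hy := sin_mul_pos (sub_pos.2 hp) (sub_le_self p zero_le_one) hφ
  have hz := sin_mul_pos (zero_lt_one.trans hp) le_rfl hφ
  have h := hasDerivAt_sin_mul_div_sin_mul_mul_exp 1 hz.ne' hy.ne'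
  simp only [one_mul, Complex.ofReal_one] at h
  exact h

theorem hasDerivAt_fussCatalanCurve_sub_one (hp : 1 < p) (hφ : φ ∈ Ioo 0 (Real.pi / p)) :
    HasDerivAt (fun φ => fussCatalanCurve p φ - 1) ((fussCatalanCurve p φ - 1) *
      ((Real.cot φ - (p - 1) * Real.cot ((p - 1) * φ) : ℝ) + p * Complex.I)) φ := by
  have hx := sin_mul_pos one_pos hp.le hφ
  have hy {ψ : ℝ} (hψ : ψ ∈ Ioo 0 (Real.pi / p)) :=
    (sin_mul_pos (sub_pos.2 hp) (sub_le_self p zero_le_one) hψ).ne'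
  have h := hasDerivAt_sin_mul_div_sin_mul_mul_exp p hx.ne' (hy hφ)
  simp only [one_mul] at h
  rw [fussCatalanCurve_sub_one (hy hφ)]
  refine h.congr_of_eventuallyEq ?_
  filter_upwards [isOpen_Ioo.mem_nhds hφ] with ψ hψ using fussCatalanCurve_sub_one (hy hψ)

theorem inv_sub_div_mul_deriv_fussCatalanCurve (hp : 1 < p) (hφ : φ ∈ Ioo 0 (Real.pi / p)) :
    ((fussCatalanCurve p φ - 1)⁻¹ - p / fussCatalanCurve p φ) * (fussCatalanCurve p φ *
      ((p * Real.cot (p * φ) - (p - 1) * Real.cot ((p - 1) * φ) : ℝ) + Complex.I)) =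
      fussCatalanLogDeriv p φ := by
  have him := fussCatalanCurve_im_pos hp hφ
  have hne : fussCatalanCurve p φ ≠ 0 := fun h => by simp [h] at him
  have hne' := sub_one_ne_zero_of_im_pos him
  have h := ((hasDerivAt_fussCatalanCurve hp hφ).sub_const 1).unique
    (hasDerivAt_fussCatalanCurve_sub_one hp hφ)
  rw [sub_mul, h, inv_mul_cancel_left₀ hne', ← h, div_mul_eq_mul_div, mul_div_assoc,
    mul_div_cancel_left₀ _ hne, fussCatalanLogDeriv]
  push_cast
  ring

theorem tendsto_fussCatalanCurve_zero (hp : 1 < p) :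
    Tendsto (fussCatalanCurve p) (𝓝[>] 0) (𝓝 ((p / (p - 1) : ℝ) : ℂ)) := by
  have hmod := (Complex.continuous_ofReal.tendsto _).comp <|
    (tendsto_sin_mul_div_sin_mul p (sub_pos.2 hp).ne').mono_left
      (nhdsWithin_mono 0 fun φ (hφ : 0 < φ) => hφ.ne')
  have hexp : Continuous fun φ : ℝ => Complex.exp (φ * Complex.I) := by fun_prop
  have h := hmod.mul ((hexp.tendsto 0).mono_left nhdsWithin_le_nhds)
  simp only [Complex.ofReal_zero, zero_mul, Complex.exp_zero, mul_one] at h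
  exact h

theorem tendsto_fussCatalanCurve_pi_div (hp : 1 < p) :
    Tendsto (fussCatalanCurve p) (𝓝[<] (Real.pi / p)) (𝓝 0) := by
  have hmod : ContinuousAt (fun φ => Real.sin (p * φ) / Real.sin ((p - 1) * φ)) (Real.pi / p) :=
    (hasDerivAt_sin_mul p _).continuousAt.div (hasDerivAt_sin_mul (p - 1) _).continuousAt
      (sin_sub_one_mul_pi_div_pos hp).ne'
  have hcont : ContinuousAt (fussCatalanCurve p) (Real.pi / p) :=
    (Complex.continuous_ofReal.continuousAt.comp hmod).mul (by fun_prop)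
  have hzero : fussCatalanCurve p (Real.pi / p) = 0 := by
    rw [fussCatalanCurve, mul_div_cancel₀ _ (zero_lt_one.trans hp).ne']
    simp
  exact hzero ▸ hcont.tendsto.mono_left nhdsWithin_le_nhds

theorem integral_fussCatalanParam_pow (hp : 1 < p) (hr : 0 < r) (hrp : r ≤ p) (k : ℕ) :
    IntegrableOn (fun φ => fussCatalanLogDeriv p φ * (fussCatalanParam p φ ^ k *
      ((Real.sin (p * φ) / Real.sin ((p - 1) * φ)) ^ r * Real.sin (r * φ))))
        (Ioo 0 (Real.pi / p)) ∧
    ∫ φ in Ioo 0 (Real.pi / p), fussCatalanLogDeriv p φ * (fussCatalanParam p φ ^ k *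
      ((Real.sin (p * φ) / Real.sin ((p - 1) * φ)) ^ r * Real.sin (r * φ))) =
        Real.pi * fussCatalanNumber p r k := by
  have hp0 : 0 < p := zero_lt_one.trans hp
  have heq {φ : ℝ} (hφ : φ ∈ Ioo 0 (Real.pi / p)) :
      (fussCatalanCurve p φ ^ ((p * k + r : ℝ) : ℂ) / (fussCatalanCurve p φ - 1) ^ k *
        ((fussCatalanCurve p φ - 1)⁻¹ - p / fussCatalanCurve p φ) * (fussCatalanCurve p φ *
        ((p * Real.cot (p * φ) - (p - 1) * Real.cot ((p - 1) * φ) : ℝ) + Complex.I))).im =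
      fussCatalanLogDeriv p φ * (fussCatalanParam p φ ^ k *
        ((Real.sin (p * φ) / Real.sin ((p - 1) * φ)) ^ r * Real.sin (r * φ))) := by
    rw [mul_assoc, inv_sub_div_mul_deriv_fussCatalanCurve hp hφ, Complex.im_mul_ofReal,
      im_fussCatalanCurve_cpow_div hp hφ, mul_comm]
  have h := (hasImArcIntegral_fussCatalanNumber hp.le hr k).integral_Ioo
    (div_pos Real.pi_pos hp0) (fun φ hφ => hasDerivAt_fussCatalanCurve hp hφ)
    (fun φ hφ => fussCatalanCurve_im_pos hp hφ)
    (fun φ hφ => by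
      have hy := sin_mul_pos (sub_pos.2 hp) (sub_le_self p zero_le_one) hφ
      have hz := sin_mul_pos hp0 le_rfl hφ
      have hw := sin_mul_pos hr hrp hφ
      have hρ := fussCatalanParam_pos hp hφ
      have hD := fussCatalanLogDeriv_pos hp hφ
      rw [heq hφ]
      positivity)
    ((one_lt_div (sub_pos.2 hp)).2 (sub_one_lt p))
    (tendsto_fussCatalanCurve_zero hp) (tendsto_fussCatalanCurve_pi_div hp)
  rwa [integrableOn_congr_fun (fun φ hφ => heq hφ) measurableSet_Ioo,
    setIntegral_congr_fun measurableSet_Ioo fun φ hφ => heq hφ] at h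

end Curve

section Density

variable {p r φ : ℝ}

/-- The Fuss-Catalan density at `fussCatalanParam p φ`, as a function of `φ ∈ (0, π / p)`. -/
noncomputable def fussCatalanAngularDensity (p r φ : ℝ) : ℝ :=
  Real.sin ((p - 1) * φ) ^ (p - r - 1) * Real.sin φ * Real.sin (r * φ) /
    (Real.pi * Real.sin (p * φ) ^ (p - r))

theorem fussCatalanAngularDensity_nonneg (hp : 1 < p) (hr : 0 < r) (hrp : r ≤ p)
    (hφ : φ ∈ Ioo 0 (Real.pi / p)) : 0 ≤ fussCatalanAngularDensity p r φ := by
  have hx := sin_pos_of_mem_Ioo_pi_div hp.le hφ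
  have hy := sin_mul_pos (sub_pos.2 hp) (sub_le_self p zero_le_one) hφ
  have hz := sin_mul_pos (zero_lt_one.trans hp) le_rfl hφ
  have hw := sin_mul_pos hr hrp hφ
  unfold fussCatalanAngularDensity
  positivity

theorem fussCatalanParam_mul_angularDensity (hp : 1 < p) (hφ : φ ∈ Ioo 0 (Real.pi / p)) (r : ℝ) :
    fussCatalanParam p φ * fussCatalanAngularDensity p r φ =
      (Real.sin (p * φ) / Real.sin ((p - 1) * φ)) ^ r * Real.sin (r * φ) / Real.pi := by
  have hx := sin_pos_of_mem_Ioo_pi_div hp.le hφ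
  have hy := sin_mul_pos (sub_pos.2 hp) (sub_le_self p zero_le_one) hφ
  have hz := sin_mul_pos (zero_lt_one.trans hp) le_rfl hφ
  have hyr := Real.rpow_pos_of_pos hy r
  have hyp := Real.rpow_pos_of_pos hy p
  have hzr := Real.rpow_pos_of_pos hz r
  have hzp := Real.rpow_pos_of_pos hz p
  unfold fussCatalanParam fussCatalanAngularDensity
  rw [Real.div_rpow hz.le hy.le, Real.rpow_sub_one hy.ne', Real.rpow_sub_one hy.ne',
    Real.rpow_sub hy, Real.rpow_sub hz]
  generalize Real.sin ((p - 1) * φ) ^ r = yr, Real.sin ((p - 1) * φ) ^ p = yp,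
    Real.sin (p * φ) ^ r = zr, Real.sin (p * φ) ^ p = zp at hyr hyp hzr hzp ⊢
  generalize Real.sin ((p - 1) * φ) = y at hy ⊢
  field_simp

theorem fussCatalanAngularDensity_eq_mul (hp : 1 < p) (hφ : φ ∈ Ioo 0 (Real.pi / p)) (r : ℝ) :
    fussCatalanAngularDensity p r φ =
      (Real.sin ((p - 1) * φ) / Real.sin (p * φ)) ^ (p - r - 1) *
        (Real.sin φ * Real.sin (r * φ) / Real.sin (p * φ)) / Real.pi := by
  have hy := sin_mul_pos (sub_pos.2 hp) (sub_le_self p zero_le_one) hφ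
  have hz := sin_mul_pos (zero_lt_one.trans hp) le_rfl hφ
  have hzpr := Real.rpow_pos_of_pos hz (p - r)
  rw [fussCatalanAngularDensity, Real.div_rpow hy.le hz.le, Real.rpow_sub_one hz.ne']
  generalize Real.sin (p * φ) ^ (p - r) = zpr at hzpr ⊢
  field_simp

theorem monotoneOn_sin_mul_mul_sin_mul_div_sin_mul {a b c : ℝ} (ha : 0 < a) (hb : 0 < b)
    (habc : a + b ≤ c) :
    MonotoneOn (fun φ => Real.sin (a * φ) * Real.sin (b * φ) / Real.sin (c * φ))
      (Ioo 0 (Real.pi / c)) := by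
  wlog hab : a ≤ b generalizing a b
  · simpa only [mul_comm] using this hb ha (by linarith) (le_of_not_ge hab)
  intro φ hφ ψ hψ hφψ
  have hacψ := mul_mem_Ioo_zero_pi (by linarith : 0 < c) le_rfl hψ
  have hsin : Real.sin (a * φ) ≤ Real.sin (a * ψ) :=
    Real.sin_le_sin_of_le_of_le_pi_div_two
      (by linarith [mul_pos ha hφ.1, Real.pi_pos]) (by nlinarith [hψ.1, hacψ.2]) (by gcongr)
  have hratio := monotoneOn_sin_mul_div_sin_mul hb (by linarith) hφ hψ hφψ
  have hbφ := sin_mul_pos hb (by linarith) hφ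
  have hcφ := sin_mul_pos (by linarith : 0 < c) le_rfl hφ
  simp only [mul_div_assoc] at hratio ⊢
  exact mul_le_mul hsin hratio (div_pos hbφ hcφ).le (sin_mul_pos ha (by linarith) hψ).le

theorem monotoneOn_fussCatalanAngularDensity (hr : 0 < r) (hrp : r + 1 ≤ p) :
    MonotoneOn (fussCatalanAngularDensity p r) (Ioo 0 (Real.pi / p)) := by
  have hp : 1 < p := by linarith
  intro φ hφ ψ hψ hφψ
  rw [fussCatalanAngularDensity_eq_mul hp hφ, fussCatalanAngularDensity_eq_mul hp hψ]
  have hratio := monotoneOn_sin_mul_div_sin_mul (sub_pos.2 hp) (sub_le_self p zero_le_one)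
    hφ hψ hφψ
  have hprod := monotoneOn_sin_mul_mul_sin_mul_div_sin_mul one_pos hr (by linarith) hφ hψ hφψ
  simp only [one_mul] at hratio hprod
  have hpos {θ : ℝ} (hθ : θ ∈ Ioo 0 (Real.pi / p)) :
      0 < Real.sin ((p - 1) * θ) / Real.sin (p * θ) :=
    div_pos (sin_mul_pos (sub_pos.2 hp) (sub_le_self p zero_le_one) hθ)
      (sin_mul_pos (zero_lt_one.trans hp) le_rfl hθ)
  have hnonneg : 0 ≤ Real.sin φ * Real.sin (r * φ) / Real.sin (p * φ) :=
    div_nonneg (mul_pos (sin_pos_of_mem_Ioo_pi_div hp.le hφ) (sin_mul_pos hr (by linarith) hφ)).le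
      (sin_mul_pos (zero_lt_one.trans hp) le_rfl hφ).le
  have hpow := Real.rpow_le_rpow (hpos hφ).le hratio (by linarith : 0 ≤ p - r - 1)
  exact div_le_div_of_nonneg_right
    (mul_le_mul hpow hprod hnonneg (Real.rpow_nonneg (hpos hψ).le _)) Real.pi_pos.le

/-- The density of the Fuss-Catalan distribution with parameters `p, r`: the value at
`fussCatalanParam p φ` is `fussCatalanAngularDensity p r φ`, and all other values are `0`. -/
noncomputable def fussCatalanDensity (p r : ℝ) : ℝ → ℝ :=
  Function.extend ((Ioo 0 (Real.pi / p)).domRestrict (fussCatalanParam p))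
    ((Ioo 0 (Real.pi / p)).domRestrict (fussCatalanAngularDensity p r)) 0

theorem fussCatalanDensity_fussCatalanParam (hp : 1 < p) (hφ : φ ∈ Ioo 0 (Real.pi / p)) (r : ℝ) :
    fussCatalanDensity p r (fussCatalanParam p φ) = fussCatalanAngularDensity p r φ :=
  (injOn_iff_injective.1 (strictAntiOn_fussCatalanParam hp).injOn).extend_apply _ _ ⟨φ, hφ⟩

theorem fussCatalanDensity_of_notMem {x : ℝ} (hx : x ∉ fussCatalanParam p '' Ioo 0 (Real.pi / p)) :
    fussCatalanDensity p r x = 0 :=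
  Function.extend_apply' _ _ _ fun ⟨φ, hφ⟩ => hx ⟨φ, φ.2, hφ⟩

theorem measurable_fussCatalanDensity (hp : 1 < p) (r : ℝ) :
    Measurable (fussCatalanDensity p r) := by
  have hcont : ContinuousOn (fussCatalanParam p) (Ioo 0 (Real.pi / p)) := fun φ hφ =>
    (hasDerivAt_fussCatalanParam hp hφ).continuousAt.continuousWithinAt
  refine (hcont.measurableEmbedding measurableSet_Ioo
    (strictAntiOn_fussCatalanParam hp).injOn).measurable_extend ?_ measurable_zero
  have hmeas : Measurable (fussCatalanAngularDensity p r) := by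
    unfold fussCatalanAngularDensity
    fun_prop
  exact hmeas.comp measurable_subtype_coe

theorem fussCatalanDensity_nonneg (hp : 1 < p) (hr : 0 < r) (hrp : r ≤ p) (x : ℝ) :
    0 ≤ fussCatalanDensity p r x := by
  by_cases hx : x ∈ fussCatalanParam p '' Ioo 0 (Real.pi / p)
  · obtain ⟨φ, hφ, rfl⟩ := hx
    rw [fussCatalanDensity_fussCatalanParam hp hφ]
    exact fussCatalanAngularDensity_nonneg hp hr hrp hφ
  · rw [fussCatalanDensity_of_notMem hx]

theorem fussCatalanDensity_of_nonpos (hp : 1 < p) {x : ℝ} (hx : x ≤ 0) :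
    fussCatalanDensity p r x = 0 :=
  fussCatalanDensity_of_notMem fun ⟨_, hφ, hφx⟩ => (hφx ▸ hx).not_gt (fussCatalanParam_pos hp hφ)

theorem mem_image_fussCatalanParam_of_le (hp : 1 < p) {x y : ℝ} (hx : 0 < x) (hxy : x ≤ y)
    (hy : y ∈ fussCatalanParam p '' Ioo 0 (Real.pi / p)) :
    x ∈ fussCatalanParam p '' Ioo 0 (Real.pi / p) := by
  have hconn : (fussCatalanParam p '' Ioo 0 (Real.pi / p)).OrdConnected :=
    (isPreconnected_Ioo.image _ fun φ hφ =>
      (hasDerivAt_fussCatalanParam hp hφ).continuousAt.continuousWithinAt).ordConnected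
  obtain ⟨φ, hφx, hφ⟩ := (((tendsto_fussCatalanParam_pi_div hp).eventually (gt_mem_nhds hx)).and
    (Ioo_mem_nhdsLT (div_pos Real.pi_pos (zero_lt_one.trans hp)))).exists
  exact hconn.out (mem_image_of_mem _ hφ) hy ⟨hφx.le, hxy⟩

theorem antitoneOn_fussCatalanDensity (hr : 0 < r) (hrp : r + 1 ≤ p) :
    AntitoneOn (fussCatalanDensity p r) (Ioi 0) := by
  have hp : 1 < p := by linarith
  intro x hx y _ hxy
  by_cases hy : y ∈ fussCatalanParam p '' Ioo 0 (Real.pi / p)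
  · obtain ⟨φ, hφ, rfl⟩ := mem_image_fussCatalanParam_of_le hp hx hxy hy
    obtain ⟨ψ, hψ, rfl⟩ := hy
    rw [fussCatalanDensity_fussCatalanParam hp hφ, fussCatalanDensity_fussCatalanParam hp hψ]
    exact monotoneOn_fussCatalanAngularDensity hr hrp hψ hφ
      (((strictAntiOn_fussCatalanParam hp).le_iff_ge hφ hψ).1 hxy)
  · rw [fussCatalanDensity_of_notMem hy]
    exact fussCatalanDensity_nonneg hp hr (by linarith) x

theorem isUnimodalWithMode_withDensity_fussCatalanDensity (hr : 0 < r) (hrp : r + 1 ≤ p) :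
    IsUnimodalWithMode (volume.withDensity fun x => ENNReal.ofReal (fussCatalanDensity p r x)) 0 :=
  have hp : 1 < p := by linarith
  ⟨0, fussCatalanDensity p r, fussCatalanDensity_nonneg hp hr (by linarith),
    monotoneOn_const.congr fun _ hx => (fussCatalanDensity_of_nonpos hp (le_of_lt hx)).symm,
    antitoneOn_fussCatalanDensity hr hrp, by simp⟩

theorem integral_fussCatalanDensity_mul_pow (hp : 1 < p) (hr : 0 < r) (hrp : r ≤ p) (k : ℕ) :
    Integrable (fun x => fussCatalanDensity p r x * x ^ k) ∧
      ∫ x, fussCatalanDensity p r x * x ^ k = fussCatalanNumber p r k := by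
  obtain ⟨hint, hval⟩ := integral_fussCatalanParam_pow hp hr hrp k
  have hderiv (φ : ℝ) (hφ : φ ∈ Ioo 0 (Real.pi / p)) :=
    (hasDerivAt_fussCatalanParam hp hφ).hasDerivWithinAt (s := Ioo 0 (Real.pi / p))
  have hinj := (strictAntiOn_fussCatalanParam hp).injOn
  have hzero (x : ℝ) (hx : x ∉ fussCatalanParam p '' Ioo 0 (Real.pi / p)) :
      fussCatalanDensity p r x * x ^ k = 0 := by
    rw [fussCatalanDensity_of_notMem hx, zero_mul]
  have hsubst : EqOn (fun φ => |-(fussCatalanParam p φ * fussCatalanLogDeriv p φ)| •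
      (fussCatalanDensity p r (fussCatalanParam p φ) * fussCatalanParam p φ ^ k))
      (fun φ => Real.pi⁻¹ * (fussCatalanLogDeriv p φ * (fussCatalanParam p φ ^ k *
        ((Real.sin (p * φ) / Real.sin ((p - 1) * φ)) ^ r * Real.sin (r * φ)))))
      (Ioo 0 (Real.pi / p)) := fun φ hφ => by
    have hρ := fussCatalanParam_pos hp hφ
    have hD := fussCatalanLogDeriv_pos hp hφ
    have hρW := fussCatalanParam_mul_angularDensity hp hφ r
    simp only [abs_neg, smul_eq_mul, abs_of_pos (mul_pos hρ hD),
      fussCatalanDensity_fussCatalanParam hp hφ]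
    linear_combination fussCatalanLogDeriv p φ * fussCatalanParam p φ ^ k * hρW
  constructor
  · rw [← integrableOn_iff_integrable_of_support_subset
      (fun x hx => by_contra fun h => hx (hzero x h)),
      integrableOn_image_iff_integrableOn_abs_deriv_smul measurableSet_Ioo hderiv hinj,
      integrableOn_congr_fun hsubst measurableSet_Ioo]
    exact hint.const_mul _
  · rw [← setIntegral_eq_integral_of_forall_compl_eq_zero hzero,
      integral_image_eq_integral_abs_deriv_smul measurableSet_Ioo hderiv hinj,
      setIntegral_congr_fun measurableSet_Ioo hsubst, integral_const_mul, hval,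
      inv_mul_cancel_left₀ Real.pi_ne_zero]

end Density

section Distribution

variable {p r : ℝ}

theorem isFussCatalanDistribution_withDensity {W : ℝ → ℝ} (hmeas : Measurable W)
    (hnonneg : ∀ x, 0 ≤ W x) (hint : ∀ k : ℕ, Integrable fun x => W x * x ^ k)
    (hval : ∀ k : ℕ, ∫ x, W x * x ^ k = fussCatalanNumber p r k) :
    IsFussCatalanDistribution p r (volume.withDensity fun x => ENNReal.ofReal (W x)) := by
  have hmoment (k : ℕ) : ∫ x, x ^ k ∂(volume.withDensity fun x => ENNReal.ofReal (W x)) =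
      fussCatalanNumber p r k := by
    rw [integral_withDensity_eq_integral_toReal_smul hmeas.ennreal_ofReal (by simp)]
    simpa only [ENNReal.toReal_ofReal (hnonneg _), smul_eq_mul] using hval k
  refine ⟨⟨?_⟩, fun k => ?_, hmoment⟩
  · have h := hmoment 0
    simp only [pow_zero, integral_const, smul_eq_mul, mul_one, fussCatalanNumber] at h
    exact (ENNReal.toReal_eq_one_iff _).1 h
  · rw [integrable_withDensity_iff_integrable_smul' hmeas.ennreal_ofReal (by simp)]
    simpa only [ENNReal.toReal_ofReal (hnonneg _), smul_eq_mul] using hint k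

theorem IsFussCatalanDistribution.eq_of_ae_abs_le {μ ν : Measure ℝ} {C : ℝ}
    (hμ : IsFussCatalanDistribution p r μ) (hν : IsFussCatalanDistribution p r ν)
    (hC : ∀ᵐ x ∂ν, |x| ≤ C) : μ = ν := by
  have := hμ.isProbabilityMeasure
  have := hν.isProbabilityMeasure
  obtain ⟨x, hx⟩ := hC.exists
  refine measure_eq_of_integral_pow_eq hμ.integrable_pow hν.integrable_pow
    (fun k => (hμ.integral_pow k).trans (hν.integral_pow k).symm)
    ((abs_nonneg x).trans hx) fun k => ?_
  calc ∫ x, x ^ (2 * k) ∂ν ≤ ∫ _, C ^ (2 * k) ∂ν := by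
        refine integral_mono_ae (hν.integrable_pow _) (integrable_const _) ?_
        filter_upwards [hC] with x hx
        rw [← (even_two_mul k).pow_abs]
        gcongr
    _ = C ^ (2 * k) := by simp

theorem isFussCatalanDistribution_withDensity_fussCatalanDensity (hp : 1 < p) (hr : 0 < r)
    (hrp : r ≤ p) : IsFussCatalanDistribution p r
      (volume.withDensity fun x => ENNReal.ofReal (fussCatalanDensity p r x)) :=
  isFussCatalanDistribution_withDensity (measurable_fussCatalanDensity hp r)
    (fussCatalanDensity_nonneg hp hr hrp)
    (fun k => (integral_fussCatalanDensity_mul_pow hp hr hrp k).1)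
    (fun k => (integral_fussCatalanDensity_mul_pow hp hr hrp k).2)

theorem ae_abs_le_withDensity_fussCatalanDensity (hp : 1 < p) (r : ℝ) :
    ∀ᵐ x ∂(volume.withDensity fun x => ENNReal.ofReal (fussCatalanDensity p r x)),
      |x| ≤ p ^ p / (p - 1) ^ (p - 1) := by
  rw [ae_withDensity_iff (measurable_fussCatalanDensity hp r).ennreal_ofReal]
  refine Eventually.of_forall fun x hx => ?_
  obtain ⟨φ, hφ, rfl⟩ : x ∈ fussCatalanParam p '' Ioo 0 (Real.pi / p) := by
    by_contra h
    exact hx (by rw [fussCatalanDensity_of_notMem h, ENNReal.ofReal_zero])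
  rw [abs_of_pos (fussCatalanParam_pos hp hφ)]
  exact fussCatalanParam_le hp hφ

theorem IsFussCatalanDistribution.eq_withDensity (hp : 1 < p) (hr : 0 < r) (hrp : r ≤ p)
    {μ : Measure ℝ} (hμ : IsFussCatalanDistribution p r μ) :
    μ = volume.withDensity fun x => ENNReal.ofReal (fussCatalanDensity p r x) :=
  hμ.eq_of_ae_abs_le (isFussCatalanDistribution_withDensity_fussCatalanDensity hp hr hrp)
    (ae_abs_le_withDensity_fussCatalanDensity hp r)

end Distribution

theorem mainTheorem8_general (p r : ℝ) (hr : 0 < r) (hrp : r + 1 ≤ p) :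
    (∃! μ : Measure ℝ, IsFussCatalanDistribution p r μ) ∧
    ∀ μ : Measure ℝ, IsFussCatalanDistribution p r μ →
      IsUnimodal μ ∧
      ∃ W : ℝ → ℝ, Measurable W ∧ (∀ x, 0 ≤ W x) ∧
        μ = volume.withDensity (fun x => ENNReal.ofReal (W x)) ∧
        (∀ x, x ∉ fussCatalanParam p '' Ioo 0 (Real.pi / p) → W x = 0) ∧
        (∀ φ ∈ Ioo 0 (Real.pi / p),
          W (fussCatalanParam p φ) =
            Real.sin ((p - 1) * φ) ^ (p - r - 1) * Real.sin φ * Real.sin (r * φ) /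
              (Real.pi * Real.sin (p * φ) ^ (p - r))) ∧
        MonotoneOn (fun φ => W (fussCatalanParam p φ)) (Ioo 0 (Real.pi / p)) := by
  have hp : 1 < p := by linarith
  have hrp' : r ≤ p := by linarith
  have hdistr := isFussCatalanDistribution_withDensity_fussCatalanDensity hp hr hrp'
  refine ⟨⟨_, hdistr, fun μ hμ => hμ.eq_withDensity hp hr hrp'⟩, fun μ hμ => ?_⟩
  rw [hμ.eq_withDensity hp hr hrp']
  exact ⟨⟨0, isUnimodalWithMode_withDensity_fussCatalanDensity hr hrp⟩, fussCatalanDensity p r,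
    measurable_fussCatalanDensity hp r, fussCatalanDensity_nonneg hp hr hrp', rfl,
    fun x hx => fussCatalanDensity_of_notMem hx,
    fun φ hφ => fussCatalanDensity_fussCatalanParam hp hφ r,
    (monotoneOn_fussCatalanAngularDensity hr hrp).congr fun φ hφ =>
      (fussCatalanDensity_fussCatalanParam hp hφ r).symm⟩

theorem mainTheorem8 (r : ℝ) (hr : 1 ≤ r) :
    (∃! μ : Measure ℝ, IsFussCatalanDistribution (2 * r) r μ) ∧
    ∀ μ : Measure ℝ, IsFussCatalanDistribution (2 * r) r μ →
      IsUnimodal μ ∧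
      ∃ W : ℝ → ℝ, Measurable W ∧ (∀ x, 0 ≤ W x) ∧
        μ = volume.withDensity (fun x => ENNReal.ofReal (W x)) ∧
        (∀ x, x ∉ fussCatalanParam (2 * r) '' Ioo 0 (Real.pi / (2 * r)) → W x = 0) ∧
        (∀ φ ∈ Ioo 0 (Real.pi / (2 * r)),
          W (fussCatalanParam (2 * r) φ) =
            Real.sin ((2 * r - 1) * φ) ^ (r - 1) * Real.sin φ * Real.sin (r * φ) /
              (Real.pi * Real.sin (2 * r * φ) ^ r)) ∧
        MonotoneOn (fun φ => W (fussCatalanParam (2 * r) φ)) (Ioo 0 (Real.pi / (2 * r))) := by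
  simpa only [show 2 * r - r = r by ring] using
    mainTheorem8_general (2 * r) r (by linarith) (by linarith)
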